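/- Let $\pi:E\to M$ be a smooth fibred manifold (a surjective submersion, for instance a fibre bundle), $\dim M=n$, $\dim E=n+k$; indices $i,j$ run over $1,\dots,n$ and $A,B$ over $1,\dots,k$, and repeated indices are summed. Let $L_\pi E$ be the adapted frame bundle: its points are $u=(e_i,e_A)_e$, where $e\in E$ and $(e_i,e_A)$ is a basis of $T_eE$ with $\pi_*e_A=0$; it is a smooth manifold, with projection $\lambda(u)=e$, on which the group $G_V$ of invertible block lower triangular matrices $\begin{pmatrix}A&0\\C&B\end{pmatrix}$ acts on the right by $(u\cdot g)_\beta=g^\alpha_\beta\,u_\alpha$. For $\xi$ in the Lie algebra of $G_V$ let $\xi^*(u)=\frac{d}{dt}\big|_{t=0}u\cdot\exp(t\xi)$; in particular $E^{*i}_j,\ E^{*i}_A,\ E^{*A}_B$ are the fundamental vector fields of the elementary matrices $r_i\mapsto r_j$, $r_i\mapsto r_A$, $r_A\mapsto r_B$. Let $\theta^i,\theta^A$ be the components of the soldering form: $\lambda_*X=\theta^i(X)e_i+\theta^A(X)e_A$ for $X\in T_u(L_\pi E)$. Let $L:L_\pi E\to\mathbb R$ be a smooth lifted Lagrangian, i.e.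 $E^{*i}_j(L)=0$ and $E^{*A}_B(L)=0$ for all indices. Its Cartan–Hamilton–Poincaré $1$-forms, with normalisation $\tau(n)=\frac1n$, are $$\theta^i_L=\tfrac1n\,L\,\theta^i+E^{*i}_A(L)\,\theta^A ,\qquad \theta^A_L=\theta^A .$$ Let $\Lambda$ be a contravariant volume on $M$: a nowhere vanishing $n$-vector field that is locally of the form $f_1\wedge\dots\wedge f_n$ with smooth vector fields $f_i$. Let $\sigma:L_\pi E\to\mathbb R$ be defined by $$\pi_*e_1\wedge\dots\wedge\pi_*e_n=\sigma(u)\,\Lambda(\pi(e)),\qquad u=(e_i,e_A)_e .$$ Then $\sigma$ is smooth and nowhere zero, and for every $i=1,\dots,n$ $$\theta^i_L=\frac1\sigma\,d_{\tilde J^i}(\sigma L),\qquad \tilde J^i=\tfrac1n\,E^{*i}_j\otimes\theta^j+E^{*i}_A\otimes\theta^A ,$$ where $d_{\tilde J^i}=[\iota_{\tilde J^i},d]=\iota_{\tilde J^i}d-d\,\iota_{\tilde J^i}$, and $\iota_J$ is the derivation that vanishes on functions and satisfies $(\iota_J\omega)(X)=\omega(JX)$ on $1$-forms. -/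

import Mathlib

open scoped Manifold ContDiff

noncomputable section

namespace CHP

/-! ### Fibred manifolds and the adapted frame bundle (as a set) -/

/-- A smooth fibred manifold `π : E → M` (a surjective submersion), where `dim M = n` and
`dim E = n + k`. Every smooth fibre bundle with `k`-dimensional fibre is one. -/
structure FiberedManifold (n k : ℕ) (E M : Type*)
    [TopologicalSpace E] [ChartedSpace (EuclideanSpace ℝ (Fin (n + k))) E]
    [TopologicalSpace M] [ChartedSpace (EuclideanSpace ℝ (Fin n)) M] where
  /-- the projection `π` -/
  proj : E → M
  surjective : Function.Surjective proj
  submersion : Manifold.IsSubmersion (𝓡 (n + k)) (𝓡 n) ∞ proj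

section

variable {n k : ℕ} {E M : Type*}
    [TopologicalSpace E] [ChartedSpace (EuclideanSpace ℝ (Fin (n + k))) E]
    [TopologicalSpace M] [ChartedSpace (EuclideanSpace ℝ (Fin n)) M]

/-- The adapted frame bundle `L_π E`: its points are the frames `(e_i, e_A)` at points `e` of `E`
(bases of `T_e E`) whose last `k` vectors are vertical, `π_* e_A = 0`. The index `Sum.inl i`
stands for `i`, the index `Sum.inr A` stands for `A`. -/
@[ext]
structure AdaptedFrame (π : FiberedManifold n k E M) where
  /-- the base point `e = λ(u)` -/
  pt : E
  /-- the frame `(e_i, e_A)` of `T_e E` -/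
  frame : Module.Basis (Fin n ⊕ Fin k) ℝ (TangentSpace (𝓡 (n + k)) pt)
  vertical : ∀ A : Fin k, mfderiv (𝓡 (n + k)) (𝓡 n) π.proj pt (frame (Sum.inr A)) = 0

/-! ### The smooth structure of the adapted frame bundle

In adapted coordinates `(x^i, y^A)` of `E`, an adapted frame is given by the coordinates of its base
point, the components `(v^j_i, v^A_i)` of the `e_i`, and the components `v^B_A` of the `e_A`
(the components `v^i_A` vanish). These velocity coordinates are the charts of `L_π E`. -/

/-- The model space of `L_π E`: coordinates `((x^i, y^A), (v^j_i, v^A_i), v^B_A)`. -/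
abbrev Model (n k : ℕ) : Type :=
  (EuclideanSpace ℝ (Fin n) × EuclideanSpace ℝ (Fin k)) ×
    (Fin n → EuclideanSpace ℝ (Fin n) × EuclideanSpace ℝ (Fin k)) ×
    (Fin k → EuclideanSpace ℝ (Fin k))

/-- Adapted coordinates `(x^i, y^A)` on an open subset of `E`: a chart of `E` together with a
chart of `M` such that `π` becomes the projection `(x, y) ↦ x`. -/
structure AdaptedChart (π : FiberedManifold n k E M) where
  dom : OpenPartialHomeomorph E (EuclideanSpace ℝ (Fin (n + k)))
  cod : OpenPartialHomeomorph M (EuclideanSpace ℝ (Fin n))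
  dom_mem : dom ∈ IsManifold.maximalAtlas (𝓡 (n + k)) ∞ E
  cod_mem : cod ∈ IsManifold.maximalAtlas (𝓡 n) ∞ M
  equiv : EuclideanSpace ℝ (Fin (n + k)) ≃L[ℝ]
    (EuclideanSpace ℝ (Fin n) × EuclideanSpace ℝ (Fin k))
  mapsTo : ∀ e ∈ dom.source, π.proj e ∈ cod.source
  proj_eq : ∀ e ∈ dom.source, cod (π.proj e) = (equiv (dom e)).1

namespace AdaptedChart

variable {π : FiberedManifold n k E M}

/-- The coordinate map `e ↦ (x^i(e), y^A(e))`. -/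
def coord (c : AdaptedChart π) (e : E) : EuclideanSpace ℝ (Fin n) × EuclideanSpace ℝ (Fin k) :=
  c.equiv (c.dom e)

/-- The inverse of the coordinate map. -/
def coordInv (c : AdaptedChart π) (z : EuclideanSpace ℝ (Fin n) × EuclideanSpace ℝ (Fin k)) : E :=
  c.dom.symm (c.equiv.symm z)

/-- The differential of the coordinate map: components of tangent vectors of `E`. -/
def D (c : AdaptedChart π) (e : E) :
    TangentSpace (𝓡 (n + k)) e →L[ℝ] EuclideanSpace ℝ (Fin n) × EuclideanSpace ℝ (Fin k) :=
  mfderiv (𝓡 (n + k)) 𝓘(ℝ, EuclideanSpace ℝ (Fin n) × EuclideanSpace ℝ (Fin k)) c.coord e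

/-- The frame of `ℝ^n × ℝ^k` with the given components; the last `k` vectors are vertical. -/
def compFrame (w : Model n k) :
    Fin n ⊕ Fin k → EuclideanSpace ℝ (Fin n) × EuclideanSpace ℝ (Fin k) :=
  Sum.elim w.2.1 (fun A => (0, w.2.2 A))

/-- The velocity coordinates of an adapted frame. -/
def frameCoord (c : AdaptedChart π) (u : AdaptedFrame π) : Model n k :=
  (c.coord u.pt, fun i => c.D u.pt (u.frame (Sum.inl i)),
    fun A => (c.D u.pt (u.frame (Sum.inr A))).2)

/-- The domain of the velocity coordinates: all adapted frames over the domain of the chart. -/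
def frameSource (c : AdaptedChart π) : Set (AdaptedFrame π) := {u | u.pt ∈ c.dom.source}

/-- The range of the velocity coordinates. -/
def frameTarget (c : AdaptedChart π) : Set (Model n k) :=
  {w | c.equiv.symm w.1 ∈ c.dom.target ∧ LinearIndependent ℝ (compFrame w)}

lemma coordInv_coord (c : AdaptedChart π) {e : E} (he : e ∈ c.dom.source) :
    c.coordInv (c.coord e) = e := by
  simp [coordInv, coord, he]

lemma coord_coordInv (c : AdaptedChart π)
    {z : EuclideanSpace ℝ (Fin n) × EuclideanSpace ℝ (Fin k)}
    (hz : c.equiv.symm z ∈ c.dom.target) : c.coord (c.coordInv z) = z := by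
  simp [coordInv, coord, hz]

lemma isOpen_frameTarget (c : AdaptedChart π) : IsOpen c.frameTarget := by
  have h1 : IsOpen {v : Fin n ⊕ Fin k → EuclideanSpace ℝ (Fin n) × EuclideanSpace ℝ (Fin k) |
      LinearIndependent ℝ v} := isOpen_setOfPred_linearIndependent
  have h2 : Continuous (compFrame : Model n k → _) := by
    refine continuous_pi fun a => ?_
    rcases a with i | A
    · exact (continuous_apply i).comp (continuous_fst.comp continuous_snd)
    · exact continuous_const.prodMk
        ((continuous_apply A).comp (continuous_snd.comp continuous_snd))
  exact (c.dom.open_target.preimage (c.equiv.symm.continuous.comp continuous_fst)).inter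
    (h1.preimage h2)

lemma contMDiffOn_coord (c : AdaptedChart π) :
    ContMDiffOn (𝓡 (n + k)) 𝓘(ℝ, EuclideanSpace ℝ (Fin n) × EuclideanSpace ℝ (Fin k)) ∞
      c.coord c.dom.source :=
  c.equiv.contDiff.contMDiff.comp_contMDiffOn (contMDiffOn_of_mem_maximalAtlas c.dom_mem)

lemma contMDiffOn_coordInv (c : AdaptedChart π) :
    ContMDiffOn 𝓘(ℝ, EuclideanSpace ℝ (Fin n) × EuclideanSpace ℝ (Fin k)) (𝓡 (n + k)) ∞
      c.coordInv (c.equiv.symm ⁻¹' c.dom.target) :=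
  (contMDiffOn_symm_of_mem_maximalAtlas c.dom_mem).comp
    c.equiv.symm.contDiff.contMDiff.contMDiffOn (fun _ h => h)

lemma mdifferentiableAt_coord (c : AdaptedChart π) {e : E} (he : e ∈ c.dom.source) :
    MDifferentiableAt (𝓡 (n + k)) 𝓘(ℝ, EuclideanSpace ℝ (Fin n) × EuclideanSpace ℝ (Fin k))
      c.coord e :=
  ((c.contMDiffOn_coord e he).contMDiffAt (c.dom.open_source.mem_nhds he)).mdifferentiableAt
    (by simp)

lemma D_bijective (c : AdaptedChart π) {e : E} (he : e ∈ c.dom.source) :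
    Function.Bijective (c.D e) := by
  have h2 : c.dom.MDifferentiable (𝓡 (n + k)) (𝓡 (n + k)) :=
    ⟨(contMDiffOn_of_mem_maximalAtlas c.dom_mem).mdifferentiableOn (by simp),
      (contMDiffOn_symm_of_mem_maximalAtlas c.dom_mem).mdifferentiableOn (by simp)⟩
  have h1 : HasMFDerivAt (𝓡 (n + k))
      𝓘(ℝ, EuclideanSpace ℝ (Fin n) × EuclideanSpace ℝ (Fin k)) c.coord e _ :=
    (c.equiv.toContinuousLinearMap.hasMFDerivAt (x := c.dom e)).comp e
      (h2.mdifferentiableAt he).hasMFDerivAt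
  have h3 := h2.mfderiv_bijective he
  rw [D, h1.mfderiv]
  exact c.equiv.bijective.comp h3

lemma vertical_iff (c : AdaptedChart π) {e : E} (he : e ∈ c.dom.source)
    (v : TangentSpace (𝓡 (n + k)) e) :
    mfderiv (𝓡 (n + k)) (𝓡 n) π.proj e v = 0 ↔ (c.D e v).1 = 0 := by
  have hπ : MDifferentiableAt (𝓡 (n + k)) (𝓡 n) π.proj e :=
    (π.submersion.contMDiff e).mdifferentiableAt (by simp)
  have hc : c.cod.MDifferentiable (𝓡 n) (𝓡 n) :=
    ⟨(contMDiffOn_of_mem_maximalAtlas c.cod_mem).mdifferentiableOn (by simp),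
      (contMDiffOn_symm_of_mem_maximalAtlas c.cod_mem).mdifferentiableOn (by simp)⟩
  have h1 : HasMFDerivAt (𝓡 (n + k)) (𝓡 n) (c.cod ∘ π.proj) e _ :=
    (hc.mdifferentiableAt (c.mapsTo e he)).hasMFDerivAt.comp e hπ.hasMFDerivAt
  have h2 : HasMFDerivAt (𝓡 (n + k)) 𝓘(ℝ, EuclideanSpace ℝ (Fin n)) (fun e => (c.coord e).1) e _ :=
    ((ContinuousLinearMap.fst ℝ (EuclideanSpace ℝ (Fin n))
      (EuclideanSpace ℝ (Fin k))).hasMFDerivAt (x := c.coord e)).comp e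
      (c.mdifferentiableAt_coord he).hasMFDerivAt
  have h3 : (fun e => (c.coord e).1) =ᶠ[nhds e] c.cod ∘ π.proj :=
    Filter.eventuallyEq_of_mem (c.dom.open_source.mem_nhds he) fun e' he' => (c.proj_eq e' he').symm
  have h4 := hasMFDerivAt_unique h1 (h2.congr_of_eventuallyEq h3.symm)
  have h5 := DFunLike.congr_fun h4 v
  have h6 : mfderiv (𝓡 n) (𝓡 n) c.cod (π.proj e) (mfderiv (𝓡 (n + k)) (𝓡 n) π.proj e v)
      = (c.D e v).1 := h5
  constructor
  · intro h
    rw [← h6, h, map_zero]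
    rfl
  · intro h
    apply hc.mfderiv_injective (c.mapsTo e he)
    rw [h6, h, map_zero]
    rfl

lemma compFrame_frameCoord (c : AdaptedChart π) {u : AdaptedFrame π} (hu : u ∈ c.frameSource) :
    compFrame (c.frameCoord u) = c.D u.pt ∘ u.frame := by
  funext a
  rcases a with i | A
  · rfl
  · have := (c.vertical_iff hu _).1 (u.vertical A)
    exact Prod.ext this.symm rfl

lemma bijOn_frameCoord (c : AdaptedChart π) :
    Set.BijOn c.frameCoord c.frameSource c.frameTarget := by
  refine ⟨fun u hu => ⟨?_, ?_⟩, fun u hu u' hu' h => ?_, fun w hw => ?_⟩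
  · have : u.pt ∈ c.dom.source := hu
    simp [frameCoord, coord, this]
  · rw [c.compFrame_frameCoord hu]
    exact u.frame.linearIndependent.map' (c.D u.pt).toLinearMap
      (LinearMap.ker_eq_bot.2 (c.D_bijective hu).1)
  · have h1 : u.pt = u'.pt := by
      rw [← c.coordInv_coord hu, ← c.coordInv_coord hu']
      exact congrArg c.coordInv (congrArg Prod.fst h)
    have h2 := c.compFrame_frameCoord hu
    rw [h, c.compFrame_frameCoord hu'] at h2
    rcases u with ⟨e, b, hb⟩
    rcases u' with ⟨e', b', hb'⟩
    obtain rfl : e = e' := h1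
    have h3 : b = b' := Module.Basis.eq_of_apply_eq fun a =>
      (c.D_bijective hu).1 (congrFun h2 a).symm
    subst h3
    rfl
  · have he : c.coordInv w.1 ∈ c.dom.source := c.dom.map_target hw.1
    let T : TangentSpace (𝓡 (n + k)) (c.coordInv w.1) ≃ₗ[ℝ]
        (EuclideanSpace ℝ (Fin n) × EuclideanSpace ℝ (Fin k)) :=
      LinearEquiv.ofBijective (c.D (c.coordInv w.1)).toLinearMap (c.D_bijective he)
    have hT : ∀ v, c.D (c.coordInv w.1) (T.symm v) = v := fun v => T.apply_symm_apply v
    let b0 := basisOfLinearIndependentOfCardEqFinrank' (compFrame w) hw.2 (by simp)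
    have hb : ∀ a, (b0.map T.symm) a = T.symm (compFrame w a) := fun a => by simp [b0]
    refine ⟨⟨c.coordInv w.1, b0.map T.symm, fun A => ?_⟩, he, ?_⟩
    · rw [c.vertical_iff he, hb, hT]
      rfl
    · simp only [frameCoord, hb, hT]
      rw [c.coord_coordInv hw.1]
      rfl

/-- The velocity coordinates as a partial bijection (the frame `u₀` only witnesses that `L_π E` is
nonempty, which fixes irrelevant values outside the range of the coordinates). -/
def frameChart (u₀ : AdaptedFrame π) (c : AdaptedChart π) :
    PartialEquiv (AdaptedFrame π) (Model n k) :=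
  haveI : Nonempty (AdaptedFrame π) := ⟨u₀⟩
  Set.BijOn.toPartialEquiv c.frameCoord c.frameSource c.frameTarget c.bijOn_frameCoord

/-- The change of adapted coordinates on `E`. -/
def trans (c c' : AdaptedChart π) (z : EuclideanSpace ℝ (Fin n) × EuclideanSpace ℝ (Fin k)) :
    EuclideanSpace ℝ (Fin n) × EuclideanSpace ℝ (Fin k) :=
  c'.coord (c.coordInv z)

/-- The domain of the change of adapted coordinates on `E`. -/
def transSource (c c' : AdaptedChart π) :
    Set (EuclideanSpace ℝ (Fin n) × EuclideanSpace ℝ (Fin k)) :=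
  c.equiv.symm ⁻¹' c.dom.target ∩ c.coordInv ⁻¹' c'.dom.source

lemma isOpen_transSource (c c' : AdaptedChart π) : IsOpen (transSource c c') :=
  c.contMDiffOn_coordInv.continuousOn.isOpen_inter_preimage
    (c.dom.open_target.preimage c.equiv.symm.continuous) c'.dom.open_source

lemma contDiffOn_trans (c c' : AdaptedChart π) :
    ContDiffOn ℝ ∞ (trans c c') (transSource c c') :=
  contMDiffOn_iff_contDiffOn.1 (c'.contMDiffOn_coord.comp
    (c.contMDiffOn_coordInv.mono Set.inter_subset_left) (fun _ h => h.2))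

lemma D_trans (c c' : AdaptedChart π) {e : E} (he : e ∈ c.dom.source) (he' : e ∈ c'.dom.source)
    (v : TangentSpace (𝓡 (n + k)) e) :
    c'.D e v = fderiv ℝ (trans c c') (c.coord e) (c.D e v) := by
  have hmem : c.coord e ∈ transSource c c' := by
    refine ⟨?_, ?_⟩
    · simp [coord, he]
    · simpa [c.coordInv_coord he] using he'
  have h1 : DifferentiableAt ℝ (trans c c') (c.coord e) :=
    ((contDiffOn_trans c c').contDiffAt ((isOpen_transSource c c').mem_nhds hmem)).differentiableAt
      (by simp)
  have h2 : HasMFDerivAt (𝓡 (n + k))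
      𝓘(ℝ, EuclideanSpace ℝ (Fin n) × EuclideanSpace ℝ (Fin k)) (trans c c' ∘ c.coord) e _ :=
    h1.hasFDerivAt.hasMFDerivAt.comp e (c.mdifferentiableAt_coord he).hasMFDerivAt
  have h3 : c'.coord =ᶠ[nhds e] trans c c' ∘ c.coord :=
    Filter.eventuallyEq_of_mem (c.dom.open_source.mem_nhds he) fun e' he' => by
      simp [trans, c.coordInv_coord he']
  rw [D, (h2.congr_of_eventuallyEq h3).mfderiv]
  rfl

/-- The change of velocity coordinates on `L_π E`. -/
def frameTrans (c c' : AdaptedChart π) (w : Model n k) : Model n k :=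
  (trans c c' w.1, fun i => fderiv ℝ (trans c c') w.1 (w.2.1 i),
    fun A => (fderiv ℝ (trans c c') w.1 (0, w.2.2 A)).2)

lemma frameChart_trans_source (u₀ u₁ : AdaptedFrame π) (c c' : AdaptedChart π) :
    ((frameChart u₀ c).symm.trans (frameChart u₁ c')).source =
      c.frameTarget ∩ Prod.fst ⁻¹' transSource c c' := by
  ext w
  rw [PartialEquiv.trans_source]
  change (w ∈ c.frameTarget ∧ ((frameChart u₀ c).symm w).pt ∈ c'.dom.source) ↔
    (w ∈ c.frameTarget ∧ (c.equiv.symm w.1 ∈ c.dom.target ∧ c.coordInv w.1 ∈ c'.dom.source))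
  refine and_congr_right fun hw => ?_
  have h1 : (frameChart u₀ c).symm w ∈ c.frameSource := (frameChart u₀ c).map_target hw
  have h2 : c.frameCoord ((frameChart u₀ c).symm w) = w := (frameChart u₀ c).right_inv hw
  have h3 : c.coordInv w.1 = ((frameChart u₀ c).symm w).pt := by
    rw [← c.coordInv_coord h1]
    exact congrArg c.coordInv (congrArg Prod.fst h2.symm)
  rw [h3]
  exact ⟨fun h => ⟨hw.1, h⟩, fun h => h.2⟩

lemma frameChart_trans_eqOn (u₀ u₁ : AdaptedFrame π) (c c' : AdaptedChart π) :
    Set.EqOn ((frameChart u₀ c).symm.trans (frameChart u₁ c')) (frameTrans c c')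
      ((frameChart u₀ c).symm.trans (frameChart u₁ c')).source := by
  intro w hw
  have hw1 : w ∈ c.frameTarget := hw.1
  have h1 : (frameChart u₀ c).symm w ∈ c.frameSource := (frameChart u₀ c).map_target hw1
  have h1' : (frameChart u₀ c).symm w ∈ c'.frameSource := hw.2
  have h2 : c.frameCoord ((frameChart u₀ c).symm w) = w := (frameChart u₀ c).right_inv hw1
  change c'.frameCoord ((frameChart u₀ c).symm w) = _
  generalize (frameChart u₀ c).symm w = u at h1 h1' h2
  subst h2
  have hz : (c.frameCoord u).1 = c.coord u.pt := rfl
  refine Prod.ext ?_ (Prod.ext ?_ ?_)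
  · simp [frameTrans, frameCoord, trans, c.coordInv_coord h1]
  · funext i
    exact D_trans c c' h1 h1' _
  · funext A
    have h3 := congrFun (c.compFrame_frameCoord h1) (Sum.inr A)
    change (c'.D u.pt (u.frame (Sum.inr A))).2 =
      (fderiv ℝ (trans c c') (c.coord u.pt) (compFrame (c.frameCoord u) (Sum.inr A))).2
    rw [h3, D_trans c c' h1 h1']
    rfl

lemma contDiffOn_frameTrans (c c' : AdaptedChart π) :
    ContDiffOn ℝ ∞ (frameTrans c c') (Prod.fst ⁻¹' transSource c c') := by
  have h0 : ContDiffOn ℝ ∞ (fun w : Model n k => trans c c' w.1) (Prod.fst ⁻¹' transSource c c') :=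
    (contDiffOn_trans c c').comp contDiff_fst.contDiffOn (fun _ h => h)
  have h1 : ContDiffOn ℝ ∞ (fun w : Model n k => fderiv ℝ (trans c c') w.1)
      (Prod.fst ⁻¹' transSource c c') :=
    ((contDiffOn_trans c c').fderiv_of_isOpen (isOpen_transSource c c') (by simp)).comp
      contDiff_fst.contDiffOn (fun _ h => h)
  refine h0.prodMk (ContDiffOn.prodMk ?_ ?_)
  · refine contDiffOn_pi.2 fun i => h1.clm_apply (ContDiff.contDiffOn ?_)
    fun_prop
  · refine contDiffOn_pi.2 fun A => ContDiff.comp_contDiffOn contDiff_snd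
      (h1.clm_apply (ContDiff.contDiffOn ?_))
    fun_prop

lemma exists_mem_source (π : FiberedManifold n k E M) (e : E) :
    ∃ c : AdaptedChart π, e ∈ c.dom.source := by
  have h := π.submersion.isSubmersionOfComplement_complement e
  have hfin : FiniteDimensional ℝ (EuclideanSpace ℝ (Fin n) × π.submersion.complement) :=
    h.equiv.toLinearEquiv.finiteDimensional
  have hfin' : FiniteDimensional ℝ π.submersion.complement :=
    Module.Finite.of_surjective (LinearMap.snd ℝ (EuclideanSpace ℝ (Fin n)) π.submersion.complement)
      LinearMap.snd_surjective
  have hrank : Module.finrank ℝ π.submersion.complement = k := by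
    have := h.equiv.toLinearEquiv.finrank_eq
    rw [Module.finrank_prod] at this
    simpa using this.symm
  have T : π.submersion.complement ≃L[ℝ] EuclideanSpace ℝ (Fin k) :=
    ContinuousLinearEquiv.ofFinrankEq (by simp [hrank])
  refine ⟨⟨h.domChart, h.codChart, h.domChart_mem_maximalAtlas, h.codChart_mem_maximalAtlas,
    h.equiv.trans ((ContinuousLinearEquiv.refl ℝ _).prodCongr T),
    fun e he => h.source_subset_preimage_source he, fun e he => ?_⟩, h.mem_domChart_source⟩
  have h1 := Manifold.IsSubmersionAtOfComplement.writtenInCharts h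
    (show h.domChart e ∈ (h.domChart.extend (𝓡 (n + k))).target by simp [he])
  simpa [he] using h1

end AdaptedChart

/-- The atlas of velocity coordinates of `L_π E` coming from all adapted coordinates of `E`. -/
def frameAtlas (π : FiberedManifold n k E M) : ChartedSpaceCore (Model n k) (AdaptedFrame π) where
  atlas := {f | ∃ (u₀ : AdaptedFrame π) (c : AdaptedChart π), f = c.frameChart u₀}
  chartAt u := (AdaptedChart.exists_mem_source π u.pt).choose.frameChart u
  mem_chart_source u := (AdaptedChart.exists_mem_source π u.pt).choose_spec
  chart_mem_atlas u := ⟨u, _, rfl⟩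
  open_source := by
    rintro _ _ ⟨u₀, c, rfl⟩ ⟨u₁, c', rfl⟩
    rw [AdaptedChart.frameChart_trans_source]
    exact c.isOpen_frameTarget.inter ((AdaptedChart.isOpen_transSource c c').preimage continuous_fst)
  continuousOn_toFun := by
    rintro _ _ ⟨u₀, c, rfl⟩ ⟨u₁, c', rfl⟩
    refine ContinuousOn.congr ?_ (AdaptedChart.frameChart_trans_eqOn u₀ u₁ c c')
    rw [AdaptedChart.frameChart_trans_source]
    exact (AdaptedChart.contDiffOn_frameTrans c c').continuousOn.mono Set.inter_subset_right

instance (π : FiberedManifold n k E M) : TopologicalSpace (AdaptedFrame π) :=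
  (frameAtlas π).toTopologicalSpace

instance (π : FiberedManifold n k E M) : ChartedSpace (Model n k) (AdaptedFrame π) :=
  (frameAtlas π).toChartedSpace

instance (π : FiberedManifold n k E M) : IsManifold 𝓘(ℝ, Model n k) ∞ (AdaptedFrame π) := by
  refine isManifold_of_contDiffOn _ _ _ fun f f' hf hf' => ?_
  obtain ⟨_, ⟨_, rfl⟩, _, ⟨⟨u₀, c, rfl⟩, rfl⟩, rfl⟩ := hf
  obtain ⟨_, ⟨_, rfl⟩, _, ⟨⟨u₁, c', rfl⟩, rfl⟩, rfl⟩ := hf'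
  have h : ContDiffOn ℝ ∞ ((c.frameChart u₀).symm.trans (c'.frameChart u₁))
      ((c.frameChart u₀).symm.trans (c'.frameChart u₁)).source := by
    refine ContDiffOn.congr ?_ (AdaptedChart.frameChart_trans_eqOn u₀ u₁ c c')
    rw [AdaptedChart.frameChart_trans_source]
    exact (AdaptedChart.contDiffOn_frameTrans c c').mono Set.inter_subset_right
  refine h.mono fun x hx => ?_
  exact hx.1

/-! ### The structure group and fundamental vertical vector fields -/

/-- The structure group `G_V` of `L_π E`: invertible block lower triangular matrices
`(A 0; C B)`. -/
def structureGroup (n k : ℕ) : Subgroup (GL (Fin n ⊕ Fin k) ℝ) where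
  carrier := {g | (g : Matrix (Fin n ⊕ Fin k) (Fin n ⊕ Fin k) ℝ).toBlocks₁₂ = 0}
  one_mem' := by
    ext i A
    simp [Matrix.toBlocks₁₂]
  mul_mem' {g h} hg hh := by
    ext i A
    have hg' : ∀ (i : Fin n) (A : Fin k),
        (g : Matrix (Fin n ⊕ Fin k) (Fin n ⊕ Fin k) ℝ) (Sum.inl i) (Sum.inr A) = 0 :=
      fun i A => congrFun (congrFun hg i) A
    have hh' : ∀ (i : Fin n) (A : Fin k),
        (h : Matrix (Fin n ⊕ Fin k) (Fin n ⊕ Fin k) ℝ) (Sum.inl i) (Sum.inr A) = 0 :=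
      fun i A => congrFun (congrFun hh i) A
    simp [Matrix.toBlocks₁₂, Matrix.mul_apply, hg', hh']
  inv_mem' {g} hg := by
    have h1 : (g : Matrix (Fin n ⊕ Fin k) (Fin n ⊕ Fin k) ℝ).BlockTriangular
        (Sum.elim (fun _ => 1) (fun _ => 0) : Fin n ⊕ Fin k → ℕ) := by
      rintro (i | A) (j | B) h
      · simp at h
      · exact congrFun (congrFun hg i) B
      · simp at h
      · simp at h
    have : Invertible (g : Matrix (Fin n ⊕ Fin k) (Fin n ⊕ Fin k) ℝ) := g.isUnit.invertible
    have h2 := Matrix.blockTriangular_inv_of_blockTriangular h1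
    ext i A
    rw [Matrix.coe_units_inv]
    exact h2 (by simp)

/-- The Lie algebra of `G_V`: all block lower triangular matrices. -/
def structureAlgebra (n k : ℕ) : Submodule ℝ (Matrix (Fin n ⊕ Fin k) (Fin n ⊕ Fin k) ℝ) where
  carrier := {ξ | ξ.toBlocks₁₂ = 0}
  zero_mem' := rfl
  add_mem' {ξ η} hξ hη := by
    ext i A
    have h1 := congrFun (congrFun hξ i) A
    have h2 := congrFun (congrFun hη i) A
    simp only [Matrix.toBlocks₁₂, Matrix.of_apply, Matrix.zero_apply] at h1 h2
    simp [Matrix.toBlocks₁₂, h1, h2]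
  smul_mem' a ξ hξ := by
    ext i A
    have h1 := congrFun (congrFun hξ i) A
    simp only [Matrix.toBlocks₁₂, Matrix.of_apply, Matrix.zero_apply] at h1
    simp [Matrix.toBlocks₁₂, h1]

/-- The exponential map of `G_V` (the matrix exponential). -/
def groupExp (ξ : structureAlgebra n k) : structureGroup n k :=
  ⟨(Matrix.isUnit_exp (ξ : Matrix (Fin n ⊕ Fin k) (Fin n ⊕ Fin k) ℝ)).unit, by
    have h1 : (ξ : Matrix (Fin n ⊕ Fin k) (Fin n ⊕ Fin k) ℝ).BlockTriangular
        (Sum.elim (fun _ => 1) (fun _ => 0) : Fin n ⊕ Fin k → ℕ) := by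
      rintro (i | A) (j | B) h
      · simp at h
      · exact congrFun (congrFun ξ.2 i) B
      · simp at h
      · simp at h
    ext i A
    exact h1.exp (by simp)⟩

/-- The right action of `G_V` on `L_π E`: `(u · g)_β = ∑_α g^α_β u_α`. -/
def AdaptedFrame.act {π : FiberedManifold n k E M} (u : AdaptedFrame π)
    (g : structureGroup n k) : AdaptedFrame π where
  pt := u.pt
  frame := u.frame.map (Matrix.toLinearEquiv u.frame
    ((g : GL (Fin n ⊕ Fin k) ℝ) : Matrix (Fin n ⊕ Fin k) (Fin n ⊕ Fin k) ℝ)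
    ((Matrix.isUnit_iff_isUnit_det _).1 (Units.isUnit _)))
  vertical A := by
    have hg : ∀ i, ((g : GL (Fin n ⊕ Fin k) ℝ) : Matrix (Fin n ⊕ Fin k) (Fin n ⊕ Fin k) ℝ)
        (Sum.inl i) (Sum.inr A) = 0 := fun i => congrFun (congrFun g.2 i) A
    rw [Module.Basis.map_apply, Matrix.toLinearEquiv_apply, Matrix.toLin_self]
    simp [hg, u.vertical]

lemma AdaptedFrame.act_frame {π : FiberedManifold n k E M} (u : AdaptedFrame π)
    (g : structureGroup n k) (b : Fin n ⊕ Fin k) :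
    (u.act g).frame b = ∑ a, ((g : GL (Fin n ⊕ Fin k) ℝ) :
      Matrix (Fin n ⊕ Fin k) (Fin n ⊕ Fin k) ℝ) a b • u.frame a := by
  rw [AdaptedFrame.act, Module.Basis.map_apply, Matrix.toLinearEquiv_apply, Matrix.toLin_self]

/-- The fundamental vertical vector field `ξ^*(u) = d/dt (u · exp(t ξ)) |_{t = 0}`. -/
def fundamental {π : FiberedManifold n k E M} (ξ : structureAlgebra n k) (u : AdaptedFrame π) :
    TangentSpace 𝓘(ℝ, Model n k) u :=
  mfderiv 𝓘(ℝ, ℝ) 𝓘(ℝ, Model n k) (fun t : ℝ => u.act (groupExp (t • ξ))) 0 (1 : ℝ)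

/-- The basis element `E^i_j` of the Lie algebra: the endomorphism `r_i ↦ r_j` of `ℝ^(n+k)`,
that is, the matrix with a single entry `1` in row `j` and column `i`. -/
def E₁ (i j : Fin n) : structureAlgebra n k :=
  ⟨Matrix.single (Sum.inl j) (Sum.inl i) 1, by
    ext a B
    simp [Matrix.toBlocks₁₂, Matrix.single]⟩

/-- The basis element `E^i_A` of the Lie algebra: the endomorphism `r_i ↦ r_A`. -/
def E₂ (i : Fin n) (A : Fin k) : structureAlgebra n k :=
  ⟨Matrix.single (Sum.inr A) (Sum.inl i) 1, by
    ext a B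
    simp [Matrix.toBlocks₁₂, Matrix.single]⟩

/-- The basis element `E^A_B` of the Lie algebra: the endomorphism `r_A ↦ r_B`. -/
def E₃ (A B : Fin k) : structureAlgebra n k :=
  ⟨Matrix.single (Sum.inr B) (Sum.inr A) 1, by
    ext a C
    simp [Matrix.toBlocks₁₂, Matrix.single]⟩

/-! ### Forms on `L_π E` -/

/-- Differential `1`-forms on `L_π E`. -/
abbrev OneForm (π : FiberedManifold n k E M) : Type _ :=
  ∀ u : AdaptedFrame π, TangentSpace 𝓘(ℝ, Model n k) u →L[ℝ] ℝ

/-- Vector-valued `1`-forms (tensor fields of type `(1, 1)`) on `L_π E`. -/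
abbrev VectorOneForm (π : FiberedManifold n k E M) : Type _ :=
  ∀ u : AdaptedFrame π, TangentSpace 𝓘(ℝ, Model n k) u →L[ℝ] TangentSpace 𝓘(ℝ, Model n k) u

/-- The differential `d f` of a function on `L_π E`. -/
def d {π : FiberedManifold n k E M} (f : AdaptedFrame π → ℝ) : OneForm π :=
  fun u => mfderiv 𝓘(ℝ, Model n k) 𝓘(ℝ, ℝ) f u

/-- The derivation `ι_J` of degree `0`, on functions: it vanishes. -/
def ι₀ {π : FiberedManifold n k E M} (_J : VectorOneForm π) (_f : AdaptedFrame π → ℝ) :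
    AdaptedFrame π → ℝ := 0

/-- The derivation `ι_J` of degree `0`, on `1`-forms: `(ι_J η)(X) = η(J X)`. -/
def ι₁ {π : FiberedManifold n k E M} (J : VectorOneForm π) (η : OneForm π) : OneForm π :=
  fun u => (η u).comp (J u)

/-- The graded commutator `d_J = [ι_J, d] = ι_J d - d ι_J` (`ι_J` has degree `0`), on functions. -/
def dAlong {π : FiberedManifold n k E M} (J : VectorOneForm π) (f : AdaptedFrame π → ℝ) :
    OneForm π :=
  ι₁ J (d f) - d (ι₀ J f)

instance (e : E) : FiniteDimensional ℝ (TangentSpace (𝓡 (n + k)) e) :=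
  inferInstanceAs (FiniteDimensional ℝ (EuclideanSpace ℝ (Fin (n + k))))

instance (e : E) : T2Space (TangentSpace (𝓡 (n + k)) e) :=
  inferInstanceAs (T2Space (EuclideanSpace ℝ (Fin (n + k))))

/-- The components `θ^α` of the soldering form: `θ^α(X)` is the `α`-th component of `λ_* X` in
the frame `u`. -/
def soldering (π : FiberedManifold n k E M) (α : Fin n ⊕ Fin k) : OneForm π :=
  fun u => (LinearMap.toContinuousLinearMap (u.frame.coord α)).comp
    (mfderiv 𝓘(ℝ, Model n k) (𝓡 (n + k)) (AdaptedFrame.pt : AdaptedFrame π → E) u)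

/-- The vector-valued `1`-form `J̃^i = (1/n) E^{*i}_j ⊗ θ^j + E^{*i}_A ⊗ θ^A`. -/
def Jtilde (π : FiberedManifold n k E M) (i : Fin n) : VectorOneForm π :=
  fun u =>
    (1 / (n : ℝ)) • ∑ j : Fin n, (soldering π (Sum.inl j) u).smulRight (fundamental (E₁ i j) u) +
      ∑ A : Fin k, (soldering π (Sum.inr A) u).smulRight (fundamental (E₂ i A) u)

/-! ### Lifted Lagrangians and the Cartan-Hamilton-Poincaré forms -/

/-- A Lagrangian is lifted if `E^{*i}_j(L) = 0` and `E^{*A}_B(L) = 0`. -/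
def IsLifted {π : FiberedManifold n k E M} (L : AdaptedFrame π → ℝ) : Prop :=
  (∀ (i j : Fin n) (u : AdaptedFrame π), d L u (fundamental (E₁ i j) u) = 0) ∧
    ∀ (A B : Fin k) (u : AdaptedFrame π), d L u (fundamental (E₃ A B) u) = 0

/-- The Cartan-Hamilton-Poincaré `1`-forms `θ^α_L` for a normalisation `τ(n)`:
`θ^i_L = τ(n) L θ^i + E^{*i}_A(L) θ^A` and `θ^A_L = θ^A`. -/
def chpForm {π : FiberedManifold n k E M} (τ : ℕ → ℝ) (L : AdaptedFrame π → ℝ) :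
    Fin n ⊕ Fin k → OneForm π
  | Sum.inl i => fun u => (τ n * L u) • soldering π (Sum.inl i) u +
      ∑ A : Fin k, d L u (fundamental (E₂ i A) u) • soldering π (Sum.inr A) u
  | Sum.inr A => soldering π (Sum.inr A)

/-! ### Contravariant volumes and the function `σ` -/

/-- A contravariant volume on `M`: a nowhere vanishing smooth section `Λ` of `⋀^n TM`, locally of
the form `f_1 ∧ ... ∧ f_n` with smooth vector fields `f_i`. -/
structure ContravariantVolume (n : ℕ) (M : Type*)
    [TopologicalSpace M] [ChartedSpace (EuclideanSpace ℝ (Fin n)) M]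
    [IsManifold (𝓡 n) ∞ M] where
  /-- the value of `Λ` at a point -/
  val : ∀ x : M, ⋀[ℝ]^n (TangentSpace (𝓡 n) x)
  ne_zero : ∀ x, val x ≠ 0
  smooth : ∀ x : M, ∃ (U : Set M) (f : Fin n → ∀ y : M, TangentSpace (𝓡 n) y),
    IsOpen U ∧ x ∈ U ∧
    (∀ i, ContMDiffOn (𝓡 n) (𝓡 n).tangent ∞ (fun y => (⟨y, f i y⟩ : TangentBundle (𝓡 n) M)) U) ∧
    ∀ y ∈ U, val y = exteriorPower.ιMulti ℝ n (fun i => f i y)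

/-- The `n`-vector `ẽ_1 ∧ ... ∧ ẽ_n` at `π(e)`, where `ẽ_i = (π ∘ λ)_* e_i = π_* e_i`. -/
def baseVector {π : FiberedManifold n k E M} (u : AdaptedFrame π) :
    ⋀[ℝ]^n (TangentSpace (𝓡 n) (π.proj u.pt)) :=
  exteriorPower.ιMulti ℝ n fun i =>
    mfderiv (𝓡 (n + k)) (𝓡 n) π.proj u.pt (u.frame (Sum.inl i))

variable [IsManifold (𝓡 n) ∞ M]

lemma exists_sigma {π : FiberedManifold n k E M} (Λ : ContravariantVolume n M)
    (u : AdaptedFrame π) : ∃ s : ℝ, baseVector u = s • Λ.val (π.proj u.pt) := by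
  have h0 : Module.finrank ℝ (TangentSpace (𝓡 n) (π.proj u.pt)) = n :=
    finrank_euclideanSpace_fin
  have hfin : FiniteDimensional ℝ (TangentSpace (𝓡 n) (π.proj u.pt)) :=
    inferInstanceAs (FiniteDimensional ℝ (EuclideanSpace ℝ (Fin n)))
  have h1 : Module.finrank ℝ (⋀[ℝ]^n (TangentSpace (𝓡 n) (π.proj u.pt))) = 1 := by
    rw [exteriorPower.finrank_eq, h0, Nat.choose_self]
  obtain ⟨s, hs⟩ := exists_smul_eq_of_finrank_eq_one h1 (Λ.ne_zero (π.proj u.pt)) (baseVector u)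
  exact ⟨s, hs.symm⟩

/-- The function `σ` on `L_π E` determined by `ẽ_1 ∧ ... ∧ ẽ_n = σ(u) Λ(π(e))`. -/
def sigma {π : FiberedManifold n k E M} (Λ : ContravariantVolume n M) (u : AdaptedFrame π) : ℝ :=
  (exists_sigma Λ u).choose

lemma sigma_spec {π : FiberedManifold n k E M} (Λ : ContravariantVolume n M)
    (u : AdaptedFrame π) : baseVector u = sigma Λ u • Λ.val (π.proj u.pt) :=
  (exists_sigma Λ u).choose_spec

end

end CHP

end

open scoped Manifold ContDiff

noncomputable section

namespace CHP

/-! ### Matrix calculus -/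

section MatrixCalculus

variable {ι : Type*} [Fintype ι] [DecidableEq ι]

/-! The point is the equivariance of `σ`. Under `g = (A 0; C B)` the horizontal vectors become
`A^j_i e_j` plus vertical terms, which `π_*` kills, so `σ(u · g) = det(A) σ(u)` (`sigma_act`).
Differentiating along `exp(tξ)` gives `ξ^*(σ) = tr(A) σ`, with `A` now the upper left block of `ξ`
(`d_sigma_fundamental`): `E^{*i}_j(σ) = δ^i_j σ` and `E^{*i}_A(σ) = 0`. For a lifted `L` the Leibniz
rule then yields `E^{*i}_j(σL) = δ^i_j σL` and `E^{*i}_A(σL) = σ E^{*i}_A(L)`. Since `ι_J` kills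
functions, `d_J f = df ∘ J`, and inserting `J̃^i` gives `σ θ^i_L`. Smoothness and nonvanishing of
`σ` are local. Pairing its defining equation with the coordinate form `dx^1 ∧ ... ∧ dx^n` gives
`det(v^j_i) = σ · dx(Λ)` (`det_frameCoord_eq_sigma_mul`). The left side is smooth in the velocity
coordinates and nonzero because the `π_* e_i` form a basis, so `σ` is a quotient of nowhere zero
smooth functions. -/

lemma hasDerivAt_exp_smul_apply (ξ : Matrix ι ι ℝ) (a b : ι) (t : ℝ) :
    HasDerivAt (fun t : ℝ => NormedSpace.exp (t • ξ) a b)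
      ((NormedSpace.exp (t • ξ) * ξ) a b) t := by
  -- This norm only serves to make the matrices a Banach algebra; it induces the entrywise topology,
  -- so `NormedSpace.exp` is unchanged.
  let : NormedRing (Matrix ι ι ℝ) := Matrix.linftyOpNormedRing
  let : NormedAlgebra ℝ (Matrix ι ι ℝ) := Matrix.linftyOpNormedAlgebra
  have h := hasDerivAt_exp_smul_const (𝕂 := ℝ) ξ t
  let T : Matrix ι ι ℝ →L[ℝ] ℝ := LinearMap.toContinuousLinearMap
    { toFun := fun X => X a b
      map_add' := fun _ _ => rfl
      map_smul' := fun _ _ => rfl }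
  exact T.hasFDerivAt.comp_hasDerivAt t h

lemma contDiff_det {r : WithTop ℕ∞} :
    ContDiff ℝ r (fun X : ι → ι → ℝ => Matrix.det (Matrix.of X)) := by
  simp only [Matrix.det_apply, Matrix.of_apply]
  refine ContDiff.sum fun s _ => ContDiff.const_smul _ (contDiff_prod fun i _ => ?_)
  fun_prop

/-- The function is the evaluation at `t` of the polynomial `det(1 + tX)`, whose derivative at `0`
is the trace. -/
lemma hasDerivAt_det_one_add_smul (X : Matrix ι ι ℝ) :
    HasDerivAt (fun t : ℝ => Matrix.det (1 + t • X)) X.trace 0 := by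
  have h := (Matrix.det (1 + (Polynomial.X : Polynomial ℝ) • X.map Polynomial.C)).hasDerivAt 0
  rw [Matrix.derivative_det_one_add_X_smul] at h
  refine h.congr_of_eventuallyEq (Filter.Eventually.of_forall fun t => ?_)
  have h1 : 1 + t • X = (Polynomial.evalRingHom t).mapMatrix
      (1 + (Polynomial.X : Polynomial ℝ) • X.map Polynomial.C) := by
    ext i j
    by_cases hij : i = j <;> simp [hij, mul_comm t]
  change Matrix.det (1 + t • X) = Polynomial.eval t _
  rw [h1, ← Polynomial.coe_evalRingHom, RingHom.map_det]

/-- By the chain rule the derivative depends only on `X 0` and `X'`, so the curve may be replaced by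
its tangent line `1 + tX'`. -/
lemma hasDerivAt_det_of_eq_one {X : ℝ → ι → ι → ℝ} {X' : ι → ι → ℝ}
    (h1 : Matrix.of (X 0) = 1) (hX : HasDerivAt X X' 0) :
    HasDerivAt (fun t => Matrix.det (Matrix.of (X t))) (Matrix.trace (Matrix.of X')) 0 := by
  have hd := (contDiff_det (ι := ι) (r := 1)).differentiable (by simp) (X 0)
  have h2 := hd.hasFDerivAt.comp_hasDerivAt (0 : ℝ) hX
  have h3 : HasDerivAt (fun t : ℝ => X 0 + t • X') X' 0 := by
    simpa using ((hasDerivAt_id (0 : ℝ)).smul_const X').const_add (X 0)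
  have h4 : X 0 + (0 : ℝ) • X' = X 0 := by simp
  rw [← h4] at hd
  have h5 := hd.hasFDerivAt.comp_hasDerivAt (0 : ℝ) h3
  have h6 : HasDerivAt (fun t : ℝ => Matrix.det (Matrix.of (X 0 + t • X')))
      (Matrix.trace (Matrix.of X')) 0 := by
    have := hasDerivAt_det_one_add_smul (Matrix.of X')
    rw [← h1] at this
    exact this
  rw [h4] at h5
  rwa [h6.unique h5]

end MatrixCalculus

section

variable {n k : ℕ} {E M : Type*}
    [TopologicalSpace E] [ChartedSpace (EuclideanSpace ℝ (Fin (n + k))) E]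
    [TopologicalSpace M] [ChartedSpace (EuclideanSpace ℝ (Fin n)) M]
    {π : FiberedManifold n k E M}

/-! ### The velocity coordinates as charts -/

namespace AdaptedChart

/-- Turns velocity coordinates into a genuine chart, so that the smoothness of charts and their
inverses applies to `frameCoord`. -/
lemma exists_mem_atlas (c : AdaptedChart π) (u₀ : AdaptedFrame π) :
    ∃ φ ∈ atlas (Model n k) (AdaptedFrame π), φ.toPartialEquiv = c.frameChart u₀ :=
  ⟨(frameAtlas π).openPartialHomeomorph (c.frameChart u₀) ⟨u₀, c, rfl⟩,
    Set.mem_iUnion₂.2 ⟨c.frameChart u₀, ⟨u₀, c, rfl⟩, rfl⟩, rfl⟩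

lemma isOpen_frameSource (c : AdaptedChart π) : IsOpen c.frameSource := by
  -- `frameChart` takes a frame as witness, so an empty bundle is treated apart.
  rcases isEmpty_or_nonempty (AdaptedFrame π) with h | ⟨⟨u₀⟩⟩
  · rw [Set.eq_empty_of_isEmpty c.frameSource]
    exact isOpen_empty
  · obtain ⟨φ, -, hφ⟩ := c.exists_mem_atlas u₀
    have h := φ.open_source
    rw [hφ] at h
    exact h

lemma contMDiffOn_frameCoord (c : AdaptedChart π) :
    ContMDiffOn 𝓘(ℝ, Model n k) 𝓘(ℝ, Model n k) ∞ c.frameCoord c.frameSource := by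
  intro u hu
  obtain ⟨φ, hφ, h⟩ := c.exists_mem_atlas u
  have h1 := contMDiffOn_of_mem_maximalAtlas (I := 𝓘(ℝ, Model n k)) (n := ∞)
    (IsManifold.subset_maximalAtlas hφ)
  have h2 : φ.source = c.frameSource := congrArg PartialEquiv.source h
  have h3 : ⇑φ = c.frameCoord := congrArg (fun ψ : PartialEquiv _ _ => ⇑ψ) h
  rw [h2, h3] at h1
  exact h1 u hu

/-- A curve of frames which stays over the domain of an adapted chart is differentiable if its
velocity coordinates are. -/
lemma mdifferentiableAt_of_frameCoord (c : AdaptedChart π) {γ : ℝ → AdaptedFrame π}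
    (hγ : ∀ t, γ t ∈ c.frameSource) {t : ℝ}
    (h : DifferentiableAt ℝ (fun s => c.frameCoord (γ s)) t) :
    MDifferentiableAt 𝓘(ℝ, ℝ) 𝓘(ℝ, Model n k) γ t := by
  obtain ⟨φ, hφ, hc⟩ := c.exists_mem_atlas (γ 0)
  have h1 := contMDiffOn_symm_of_mem_maximalAtlas (I := 𝓘(ℝ, Model n k)) (n := ∞)
    (IsManifold.subset_maximalAtlas hφ)
  have h2 : φ.source = c.frameSource := congrArg PartialEquiv.source hc
  have h3 : ⇑φ = c.frameCoord := congrArg (fun ψ : PartialEquiv _ _ => ⇑ψ) hc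
  rw [← h3] at h
  have h4 : ∀ s, γ s ∈ φ.source := fun s => h2 ▸ hγ s
  have h5 : γ = fun s => φ.symm (φ (γ s)) := funext fun s => (φ.left_inv (h4 s)).symm
  rw [h5]
  have h6 : MDifferentiableAt 𝓘(ℝ, Model n k) 𝓘(ℝ, Model n k) φ.symm (φ (γ t)) :=
    ((h1 _ (φ.map_source (h4 t))).contMDiffAt
      (φ.open_target.mem_nhds (φ.map_source (h4 t)))).mdifferentiableAt (by simp)
  exact h6.comp t h.mdifferentiableAt

/-- In velocity coordinates `λ` is the projection to the first component. -/
lemma contMDiffOn_pt (c : AdaptedChart π) :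
    ContMDiffOn 𝓘(ℝ, Model n k) (𝓡 (n + k)) ∞ (AdaptedFrame.pt : AdaptedFrame π → E)
      c.frameSource := by
  have h1 : ContMDiffOn 𝓘(ℝ, Model n k) (𝓡 (n + k)) ∞
      (fun u : AdaptedFrame π => c.coordInv (c.frameCoord u).1) c.frameSource := by
    refine c.contMDiffOn_coordInv.comp
      ((contDiff_fst.contMDiff (n := ∞)).comp_contMDiffOn c.contMDiffOn_frameCoord) fun u hu => ?_
    have : u.pt ∈ c.dom.source := hu
    simp [frameCoord, coord, this]
  exact h1.congr fun u hu => (c.coordInv_coord hu).symm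

lemma mdifferentiableAt_cod (c : AdaptedChart π) {x : M} (hx : x ∈ c.cod.source) :
    MDifferentiableAt (𝓡 n) (𝓡 n) c.cod x :=
  ((contMDiffOn_of_mem_maximalAtlas c.cod_mem x hx).contMDiffAt
    (c.cod.open_source.mem_nhds hx)).mdifferentiableAt (by simp)

/-- The differential of the coordinates on `M`. -/
def codD (c : AdaptedChart π) (x : M) : TangentSpace (𝓡 n) x →L[ℝ] EuclideanSpace ℝ (Fin n) :=
  mfderiv (𝓡 n) (𝓡 n) c.cod x

/-- This is `proj_eq` differentiated: near `e` the map `c.cod ∘ π.proj` is the first component of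
`c.coord`. -/
lemma codD_mfderiv_proj (c : AdaptedChart π) {e : E} (he : e ∈ c.dom.source)
    (v : TangentSpace (𝓡 (n + k)) e) :
    c.codD (π.proj e) (mfderiv (𝓡 (n + k)) (𝓡 n) π.proj e v) = (c.D e v).1 := by
  have hπ : MDifferentiableAt (𝓡 (n + k)) (𝓡 n) π.proj e :=
    (π.submersion.contMDiff e).mdifferentiableAt (by simp)
  have h1 : HasMFDerivAt (𝓡 (n + k)) (𝓡 n) (c.cod ∘ π.proj) e _ :=
    (c.mdifferentiableAt_cod (c.mapsTo e he)).hasMFDerivAt.comp e hπ.hasMFDerivAt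
  have h2 : HasMFDerivAt (𝓡 (n + k)) 𝓘(ℝ, EuclideanSpace ℝ (Fin n)) (fun e => (c.coord e).1) e _ :=
    ((ContinuousLinearMap.fst ℝ (EuclideanSpace ℝ (Fin n))
      (EuclideanSpace ℝ (Fin k))).hasMFDerivAt (x := c.coord e)).comp e
      (c.mdifferentiableAt_coord he).hasMFDerivAt
  have h3 : (fun e => (c.coord e).1) =ᶠ[nhds e] c.cod ∘ π.proj :=
    Filter.eventuallyEq_of_mem (c.dom.open_source.mem_nhds he) fun e' he' => (c.proj_eq e' he').symm
  exact DFunLike.congr_fun (hasMFDerivAt_unique h1 (h2.congr_of_eventuallyEq h3.symm)) v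

end AdaptedChart

/-! ### The flows of the fundamental vector fields -/

lemma AdaptedFrame.act_groupExp_frame (u : AdaptedFrame π) (ξ : structureAlgebra n k)
    (b : Fin n ⊕ Fin k) :
    (u.act (groupExp ξ)).frame b = ∑ a, NormedSpace.exp
      (ξ : Matrix (Fin n ⊕ Fin k) (Fin n ⊕ Fin k) ℝ) a b • u.frame a :=
  u.act_frame _ b

lemma AdaptedFrame.act_groupExp_zero (u : AdaptedFrame π) (ξ : structureAlgebra n k) :
    u.act (groupExp ((0 : ℝ) • ξ)) = u := by
  have h : (u.act (groupExp ((0 : ℝ) • ξ))).frame = u.frame := by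
    refine Module.Basis.eq_of_apply_eq fun b => ?_
    rw [u.act_groupExp_frame]
    simp [Matrix.one_apply]
    rfl
  exact AdaptedFrame.ext rfl h

/-- The action fixes the base point, so the curve stays over one adapted chart, where its
coordinates are built from fixed vectors weighted by entries of `exp(tξ)`. Without differentiability
the `mfderiv` defining `fundamental` would be the default value `0`. -/
lemma AdaptedFrame.mdifferentiableAt_act_groupExp (u : AdaptedFrame π) (ξ : structureAlgebra n k)
    (t : ℝ) :
    MDifferentiableAt 𝓘(ℝ, ℝ) 𝓘(ℝ, Model n k) (fun t : ℝ => u.act (groupExp (t • ξ))) t := by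
  obtain ⟨c, hc⟩ := AdaptedChart.exists_mem_source π u.pt
  refine c.mdifferentiableAt_of_frameCoord (γ := fun t : ℝ => u.act (groupExp (t • ξ)))
    (fun _ => hc) ?_
  have h : ∀ b : Fin n ⊕ Fin k, DifferentiableAt ℝ
      (fun t : ℝ => c.D u.pt ((u.act (groupExp (t • ξ))).frame b)) t := by
    intro b
    have h1 : (fun t : ℝ => c.D u.pt ((u.act (groupExp (t • ξ))).frame b)) = fun t : ℝ =>
        ∑ a, NormedSpace.exp (t • (ξ : Matrix (Fin n ⊕ Fin k) (Fin n ⊕ Fin k) ℝ)) a b •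
          c.D u.pt (u.frame a) := by
      funext t
      rw [u.act_groupExp_frame, map_sum]
      exact Finset.sum_congr rfl fun a _ => (c.D u.pt).map_smul _ _
    rw [h1]
    refine DifferentiableAt.fun_sum fun a _ => ?_
    exact (hasDerivAt_exp_smul_apply _ a b t).differentiableAt.smul_const _
  exact (differentiableAt_const (c.coord u.pt)).prodMk
    ((differentiableAt_pi.2 fun i => h (Sum.inl i)).prodMk
      (differentiableAt_pi.2 fun A => (h (Sum.inr A)).snd))

/-- The chain rule. The point `u` is kept apart from `γ t` because the flow passes at time `0`
through `u.act (groupExp (0 • ξ))`, which is `u` only by a proved equality. -/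
lemma d_apply_mfderiv {f : AdaptedFrame π → ℝ} {γ : ℝ → AdaptedFrame π} {u : AdaptedFrame π}
    {t : ℝ} (hu : γ t = u) (hf : MDifferentiableAt 𝓘(ℝ, Model n k) 𝓘(ℝ, ℝ) f u)
    (hγ : MDifferentiableAt 𝓘(ℝ, ℝ) 𝓘(ℝ, Model n k) γ t) :
    HasDerivAt (fun s => f (γ s)) (d f u (mfderiv 𝓘(ℝ, ℝ) 𝓘(ℝ, Model n k) γ t (1 : ℝ))) t := by
  subst hu
  let A : ℝ →L[ℝ] ℝ := (d f (γ t)).comp (mfderiv 𝓘(ℝ, ℝ) 𝓘(ℝ, Model n k) γ t)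
  have h : HasFDerivAt (fun s => f (γ s)) A t :=
    (hf.hasMFDerivAt.comp t hγ.hasMFDerivAt).hasFDerivAt
  exact h.hasDerivAt

/-- The derivative of a function along a fundamental vector field is its derivative along the
flow. -/
lemma hasDerivAt_comp_act {f : AdaptedFrame π → ℝ} {u : AdaptedFrame π}
    (hf : MDifferentiableAt 𝓘(ℝ, Model n k) 𝓘(ℝ, ℝ) f u) (ξ : structureAlgebra n k) :
    HasDerivAt (fun t : ℝ => f (u.act (groupExp (t • ξ)))) (d f u (fundamental ξ u)) 0 :=
  d_apply_mfderiv (u.act_groupExp_zero ξ) hf (u.mdifferentiableAt_act_groupExp ξ 0)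

/-! ### The coordinate determinant on the base -/

namespace AdaptedChart

lemma codD_injective (c : AdaptedChart π) {x : M}
    (hx : x ∈ c.cod.source) : Function.Injective (c.codD x) :=
  OpenPartialHomeomorph.MDifferentiable.mfderiv_injective
    ⟨(contMDiffOn_of_mem_maximalAtlas c.cod_mem).mdifferentiableOn (by simp),
      (contMDiffOn_symm_of_mem_maximalAtlas c.cod_mem).mdifferentiableOn (by simp)⟩ hx

/-- The coordinate volume form `dx^1 ∧ ... ∧ dx^n` at a point of `M`. -/
def codDet (c : AdaptedChart π) (x : M) : TangentSpace (𝓡 n) x [⋀^Fin n]→ₗ[ℝ] ℝ :=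
  (Matrix.detRowAlternating (n := Fin n) (R := ℝ)).compLinearMap
    ((WithLp.linearEquiv 2 ℝ (Fin n → ℝ)).toLinearMap ∘ₗ
      (c.codD x).toLinearMap)

lemma codDet_apply (c : AdaptedChart π) (x : M) (v : Fin n → TangentSpace (𝓡 n) x) :
    c.codDet x v = Matrix.det (Matrix.of fun i j => c.codD x (v i) j) :=
  rfl

lemma codDet_mfderiv_proj (c : AdaptedChart π) {u : AdaptedFrame π} (hu : u ∈ c.frameSource) :
    c.codDet (π.proj u.pt)
        (fun i => mfderiv (𝓡 (n + k)) (𝓡 n) π.proj u.pt (u.frame (Sum.inl i))) =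
      Matrix.det (Matrix.of fun i j => ((c.frameCoord u).2.1 i).1 j) := by
  rw [codDet_apply]
  simp only [c.codD_mfderiv_proj hu]
  rfl

/-- The tangent map of the chart is smooth, so the fields have smooth components, and the
determinant is polynomial in them. -/
lemma contMDiffOn_codDet [IsManifold (𝓡 n) ∞ M] (c : AdaptedChart π) {U : Set M}
    {f : Fin n → ∀ y : M, TangentSpace (𝓡 n) y}
    (hf : ∀ i, ContMDiffOn (𝓡 n) (𝓡 n).tangent ∞
      (fun y => (⟨y, f i y⟩ : TangentBundle (𝓡 n) M)) U) :
    ContMDiffOn (𝓡 n) 𝓘(ℝ, ℝ) ∞ (fun y => c.codDet y fun i => f i y) (U ∩ c.cod.source) := by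
  have : IsManifold (𝓡 n) 1 M := IsManifold.of_le (n := ∞) (by simp)
  have h1 := (contMDiffOn_of_mem_maximalAtlas c.cod_mem).contMDiffOn_tangentMapWithin
    (m := ∞) (by simp) c.cod.open_source.uniqueMDiffOn
  have h2 : ∀ i, ContMDiffOn (𝓡 n) 𝓘(ℝ, EuclideanSpace ℝ (Fin n)) ∞
      (fun y => c.codD y (f i y)) (U ∩ c.cod.source) := by
    intro i
    have h3 := (contMDiff_snd_tangentBundle_modelSpace (n := ∞) (EuclideanSpace ℝ (Fin n))
      (𝓡 n)).comp_contMDiffOn (h1.comp ((hf i).mono Set.inter_subset_left)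
        (t := (Bundle.TotalSpace.proj ⁻¹' c.cod.source)) fun y hy => hy.2)
    refine h3.congr fun y hy => ?_
    change _ = mfderivWithin (𝓡 n) (𝓡 n) c.cod c.cod.source y (f i y)
    rw [mfderivWithin_of_isOpen c.cod.open_source hy.2]
    rfl
  have h4 : ContMDiffOn (𝓡 n) 𝓘(ℝ, Fin n → Fin n → ℝ) ∞
      (fun y i j => c.codD y (f i y) j)
      (U ∩ c.cod.source) := by
    refine contMDiffOn_pi_space.2 fun i => ?_
    exact (EuclideanSpace.equiv (Fin n) ℝ).contDiff.contMDiff.comp_contMDiffOn (h2 i)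
  exact contDiff_det.contMDiff.comp_contMDiffOn h4

end AdaptedChart

/-- In adapted coordinates `w` lifts to `(w, 0)`; injectivity of `codD` carries the equality back to
`M`. -/
lemma surjective_mfderiv_proj (π : FiberedManifold n k E M) (e : E) :
    Function.Surjective (mfderiv (𝓡 (n + k)) (𝓡 n) π.proj e) := by
  obtain ⟨c, hc⟩ := AdaptedChart.exists_mem_source π e
  intro w
  obtain ⟨v, hv⟩ := (c.D_bijective hc).2
    (c.codD (π.proj e) w, 0)
  refine ⟨v, c.codD_injective (c.mapsTo e hc) ?_⟩
  rw [c.codD_mfderiv_proj hc, hv]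

/-- The vectors `π_* e_i` of an adapted frame form a basis of the tangent space of the base. -/
lemma linearIndependent_mfderiv_proj (u : AdaptedFrame π) :
    LinearIndependent ℝ fun i : Fin n =>
      mfderiv (𝓡 (n + k)) (𝓡 n) π.proj u.pt (u.frame (Sum.inl i)) := by
  have h0 : Module.finrank ℝ (TangentSpace (𝓡 n) (π.proj u.pt)) = n :=
    finrank_euclideanSpace_fin
  -- In dimension `n` it suffices that the `n` vectors span. They do, since `π_*` is surjective and
  -- the `e_A` contribute nothing to the image.
  refine linearIndependent_of_top_le_span_of_card_eq_finrank ?_ (by simp [h0])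
  intro w _
  obtain ⟨v, rfl⟩ := surjective_mfderiv_proj π u.pt w
  rw [← u.frame.sum_repr v, Fintype.sum_sum_type, map_add, map_sum, map_sum]
  simp only [map_smul, u.vertical, smul_zero, Finset.sum_const_zero, add_zero]
  exact Submodule.sum_mem _ fun i _ =>
    Submodule.smul_mem _ _ (Submodule.subset_span (Set.mem_range_self i))

/-- The rows are the images of the independent vectors `π_* e_i` under an injective map. Through
`det(v^j_i) = σ · dx(Λ)` this makes both factors nonzero. -/
lemma AdaptedChart.det_frameCoord_ne_zero (c : AdaptedChart π) {u : AdaptedFrame π}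
    (hu : u ∈ c.frameSource) :
    Matrix.det (Matrix.of fun i j => ((c.frameCoord u).2.1 i).1 j) ≠ 0 := by
  have h1 := (linearIndependent_mfderiv_proj u).map'
    ((WithLp.linearEquiv 2 ℝ (Fin n → ℝ)).toLinearMap ∘ₗ
      (c.codD (π.proj u.pt)).toLinearMap)
    (LinearMap.ker_eq_bot.2 ((WithLp.linearEquiv 2 ℝ (Fin n → ℝ)).injective.comp
      (c.codD_injective (c.mapsTo _ hu))))
  rw [← c.codDet_mfderiv_proj hu]
  have h2 := Matrix.linearIndependent_rows_iff_isUnit.1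
    (show LinearIndependent ℝ (Matrix.row (Matrix.of fun i j =>
      c.codD (π.proj u.pt) (mfderiv (𝓡 (n + k)) (𝓡 n) π.proj u.pt (u.frame (Sum.inl i))) j))
      from h1)
  exact ((Matrix.isUnit_iff_isUnit_det _).1 h2).ne_zero

/-- The `e_A` have no `x`-components, so only the upper left block of `g` matters. -/
lemma AdaptedChart.det_frameCoord_act (c : AdaptedChart π) (u : AdaptedFrame π)
    (g : structureGroup n k) (hu : u ∈ c.frameSource) :
    Matrix.det (Matrix.of fun i j => ((c.frameCoord (u.act g)).2.1 i).1 j) =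
      Matrix.det (Matrix.toBlocks₁₁ ((g : GL (Fin n ⊕ Fin k) ℝ) :
        Matrix (Fin n ⊕ Fin k) (Fin n ⊕ Fin k) ℝ)) *
        Matrix.det (Matrix.of fun i j => ((c.frameCoord u).2.1 i).1 j) := by
  -- Frame vectors are rows here, whereas the action sums over the row index of `g`; hence the
  -- transpose.
  rw [← Matrix.det_transpose (Matrix.toBlocks₁₁ _), ← Matrix.det_mul]
  congr 1
  ext i j
  have h : ∀ A, (c.D u.pt (u.frame (Sum.inr A))).1 = 0 := fun A =>
    (c.vertical_iff hu _).1 (u.vertical A)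
  change (c.D u.pt ((u.act g).frame (Sum.inl i))).1 j = _
  rw [u.act_frame, map_sum, Fintype.sum_sum_type]
  simp [h, Prod.fst_sum, Matrix.mul_apply, Matrix.toBlocks₁₁, frameCoord]

/-! ### The forms in components -/

lemma dAlong_apply (J : VectorOneForm π) (f : AdaptedFrame π → ℝ) (u : AdaptedFrame π)
    (X : TangentSpace 𝓘(ℝ, Model n k) u) : dAlong J f u X = d f u (J u X) := by
  have h : d (ι₀ J f) u = 0 := mfderiv_const
  change d f u (J u X) - d (ι₀ J f) u X = _
  rw [h]
  exact sub_zero _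

/-- The single entry sits in row `j` and column `i`, on the diagonal exactly when `i = j`. This is
the source of the Kronecker delta in `E^{*i}_j(σ)`. -/
lemma trace_toBlocks₁₁_E₁ (i j : Fin n) :
    (E₁ (k := k) i j : Matrix (Fin n ⊕ Fin k) (Fin n ⊕ Fin k) ℝ).toBlocks₁₁.trace =
      if i = j then 1 else 0 := by
  by_cases h : i = j
  · simp [Matrix.trace, E₁, Matrix.toBlocks₁₁, Matrix.single_apply, h]
  · have h' : ∀ l, ¬(j = l ∧ i = l) := fun l hl => h (hl.2.trans hl.1.symm)
    simp [Matrix.trace, E₁, Matrix.toBlocks₁₁, Matrix.single_apply, h, h']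

lemma trace_toBlocks₁₁_E₂ (i : Fin n) (A : Fin k) :
    (E₂ i A : Matrix (Fin n ⊕ Fin k) (Fin n ⊕ Fin k) ℝ).toBlocks₁₁.trace = 0 := by
  simp [Matrix.trace, E₂, Matrix.toBlocks₁₁]

lemma Jtilde_apply (i : Fin n) (u : AdaptedFrame π) (X : TangentSpace 𝓘(ℝ, Model n k) u) :
    Jtilde π i u X =
      (1 / (n : ℝ)) • ∑ j : Fin n, soldering π (Sum.inl j) u X • fundamental (E₁ i j) u +
        ∑ A : Fin k, soldering π (Sum.inr A) u X • fundamental (E₂ i A) u := by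
  simp [Jtilde]

lemma chpForm_inl_apply (τ : ℕ → ℝ) (L : AdaptedFrame π → ℝ) (i : Fin n) (u : AdaptedFrame π)
    (X : TangentSpace 𝓘(ℝ, Model n k) u) :
    chpForm τ L (Sum.inl i) u X = τ n * L u * soldering π (Sum.inl i) u X +
      ∑ A : Fin k, d L u (fundamental (E₂ i A) u) * soldering π (Sum.inr A) u X := by
  simp [chpForm]

variable [IsManifold (𝓡 n) ∞ M] (Λ : ContravariantVolume n M)

/-! ### The function `σ` -/

/-- The functional induced on `n`-vectors by `dx^1 ∧ ... ∧ dx^n` is applied to `sigma_spec`. It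
replaces the scalar obtained by choice with an explicit equation in coordinates. -/
lemma det_frameCoord_eq_sigma_mul (c : AdaptedChart π) {u : AdaptedFrame π} (hu : u ∈ c.frameSource) :
    Matrix.det (Matrix.of fun i j => ((c.frameCoord u).2.1 i).1 j) = sigma Λ u *
      exteriorPower.alternatingMapLinearEquiv (c.codDet (π.proj u.pt)) (Λ.val (π.proj u.pt)) := by
  have h := congrArg (exteriorPower.alternatingMapLinearEquiv (c.codDet (π.proj u.pt)))
    (sigma_spec Λ u)
  rw [map_smul, baseVector, exteriorPower.alternatingMapLinearEquiv_apply_ιMulti,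
    c.codDet_mfderiv_proj hu] at h
  exact h

lemma sigma_ne_zero (u : AdaptedFrame π) : sigma Λ u ≠ 0 := by
  obtain ⟨c, hc⟩ := AdaptedChart.exists_mem_source π u.pt
  intro h
  apply c.det_frameCoord_ne_zero hc
  rw [det_frameCoord_eq_sigma_mul Λ c hc, h, zero_mul]

/-- Where `Λ = f_1 ∧ ... ∧ f_n`, the function `σ` is the quotient of `det(v^j_i)` by `dx(f_1, ...,
f_n)`. -/
lemma contMDiff_sigma :
    ContMDiff 𝓘(ℝ, Model n k) 𝓘(ℝ, ℝ) ∞ (sigma (π := π) Λ) := by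
  intro u
  obtain ⟨c, hc⟩ := AdaptedChart.exists_mem_source π u.pt
  obtain ⟨U, f, hU, hu, hf, hΛ⟩ := Λ.smooth (π.proj u.pt)
  have hp : ContMDiffOn 𝓘(ℝ, Model n k) (𝓡 n) ∞ (fun v : AdaptedFrame π => π.proj v.pt)
      c.frameSource := π.submersion.contMDiff.comp_contMDiffOn c.contMDiffOn_pt
  let V : Set (AdaptedFrame π) := c.frameSource ∩ (fun v => π.proj v.pt) ⁻¹' U
  have hV : IsOpen V := hp.continuousOn.isOpen_inter_preimage c.isOpen_frameSource hU
  have h1 : ContMDiffOn 𝓘(ℝ, Model n k) 𝓘(ℝ, ℝ) ∞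
      (fun v : AdaptedFrame π => Matrix.det (Matrix.of fun i j => ((c.frameCoord v).2.1 i).1 j))
      V := by
    have h : ContDiff ℝ ∞ fun (w : Model n k) i j => (w.2.1 i).1 j := by
      refine contDiff_pi.2 fun i => contDiff_pi.2 fun j => ?_
      fun_prop
    exact (contDiff_det.comp h).contMDiff.comp_contMDiffOn
      (c.contMDiffOn_frameCoord.mono Set.inter_subset_left)
  have h2 : ContMDiffOn 𝓘(ℝ, Model n k) 𝓘(ℝ, ℝ) ∞
      (fun v : AdaptedFrame π => c.codDet (π.proj v.pt) fun i => f i (π.proj v.pt)) V :=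
    (c.contMDiffOn_codDet hf).comp (hp.mono Set.inter_subset_left)
      fun v hv => ⟨hv.2, c.mapsTo _ hv.1⟩
  have h3 : ∀ v ∈ V,
      Matrix.det (Matrix.of fun i j => ((c.frameCoord v).2.1 i).1 j) =
        sigma Λ v * c.codDet (π.proj v.pt) fun i => f i (π.proj v.pt) := by
    intro v hv
    rw [det_frameCoord_eq_sigma_mul Λ c hv.1, hΛ _ hv.2,
      exteriorPower.alternatingMapLinearEquiv_apply_ιMulti]
  -- The denominator cannot vanish, being a factor of a nonzero determinant.
  have h4 : ∀ v ∈ V, c.codDet (π.proj v.pt) (fun i => f i (π.proj v.pt)) ≠ 0 := by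
    intro v hv h
    apply c.det_frameCoord_ne_zero hv.1
    rw [h3 v hv, h, mul_zero]
  have h5 : ContMDiffOn 𝓘(ℝ, Model n k) 𝓘(ℝ, ℝ) ∞ (sigma (π := π) Λ) V :=
    (h1.div₀ h2 h4).congr fun v hv => by
      simp only [Pi.div_apply]
      rw [h3 v hv, mul_div_cancel_right₀ _ (h4 v hv)]
  exact h5.contMDiffAt (hV.mem_nhds ⟨hc, hu⟩)

/-- The frames `u` and `u · g` lie over the same point, so the factor `dx(Λ)` is common to both
determinants and cancels. -/
lemma sigma_act (u : AdaptedFrame π) (g : structureGroup n k) :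
    sigma Λ (u.act g) = Matrix.det (Matrix.toBlocks₁₁ ((g : GL (Fin n ⊕ Fin k) ℝ) :
      Matrix (Fin n ⊕ Fin k) (Fin n ⊕ Fin k) ℝ)) * sigma Λ u := by
  obtain ⟨c, hc⟩ := AdaptedChart.exists_mem_source π u.pt
  have h1 := det_frameCoord_eq_sigma_mul Λ c (u := u.act g) hc
  have h2 := c.det_frameCoord_ne_zero hc
  rw [c.det_frameCoord_act u g hc] at h1
  rw [det_frameCoord_eq_sigma_mul Λ c hc] at h1 h2
  rw [← mul_assoc] at h1
  exact (mul_right_cancel₀ (right_ne_zero_of_mul h2) h1).symm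

/-- `ξ^*(σ) = tr(A) σ` for `ξ = (A 0; C B)`. -/
lemma d_sigma_fundamental (ξ : structureAlgebra n k) (u : AdaptedFrame π) :
    d (sigma Λ) u (fundamental ξ u) =
      (ξ : Matrix (Fin n ⊕ Fin k) (Fin n ⊕ Fin k) ℝ).toBlocks₁₁.trace * sigma Λ u := by
  have h1 := hasDerivAt_comp_act ((contMDiff_sigma (π := π) Λ u).mdifferentiableAt (by simp)) ξ
  simp only [sigma_act] at h1
  -- The upper left block of `exp(tξ)`. Only its value and derivative at `0` enter, so it need not
  -- be identified with the exponential of the block of `ξ`.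
  let X : ℝ → Fin n → Fin n → ℝ := fun t i j => NormedSpace.exp
    (t • (ξ : Matrix (Fin n ⊕ Fin k) (Fin n ⊕ Fin k) ℝ)) (Sum.inl i) (Sum.inl j)
  have h2 : HasDerivAt X (fun i j =>
      (ξ : Matrix (Fin n ⊕ Fin k) (Fin n ⊕ Fin k) ℝ) (Sum.inl i) (Sum.inl j)) 0 := by
    refine hasDerivAt_pi.2 fun i => hasDerivAt_pi.2 fun j => ?_
    have := hasDerivAt_exp_smul_apply (ξ : Matrix (Fin n ⊕ Fin k) (Fin n ⊕ Fin k) ℝ)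
      (Sum.inl i) (Sum.inl j) 0
    rw [zero_smul, NormedSpace.exp_zero, one_mul] at this
    exact this
  have h3 : Matrix.of (X 0) = 1 := by
    ext i j
    simp [X, Matrix.one_apply]
  exact h1.unique ((hasDerivAt_det_of_eq_one h3 h2).mul_const (sigma Λ u))

/-- Leibniz rule for real functions of `t` along the flow, with `ξ^*(σ) = tr(A) σ`. Pulling out `σ`
prepares the cancellation of `1/σ`. -/
lemma d_sigma_mul_fundamental {L : AdaptedFrame π → ℝ} {u : AdaptedFrame π}
    (hL : MDifferentiableAt 𝓘(ℝ, Model n k) 𝓘(ℝ, ℝ) L u) (ξ : structureAlgebra n k) :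
    d (fun v => sigma Λ v * L v) u (fundamental ξ u) = sigma Λ u *
      ((ξ : Matrix (Fin n ⊕ Fin k) (Fin n ⊕ Fin k) ℝ).toBlocks₁₁.trace * L u +
        d L u (fundamental ξ u)) := by
  have hσ := (contMDiff_sigma (π := π) Λ u).mdifferentiableAt (by simp)
  have h1 := hasDerivAt_comp_act (hσ.mul hL) ξ
  have h2 := (hasDerivAt_comp_act hσ ξ).mul (hasDerivAt_comp_act hL ξ)
  rw [u.act_groupExp_zero, d_sigma_fundamental] at h2
  exact (h1.unique h2).trans (by ring)

end

end CHP

end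

/-! ### The Cartan-Hamilton-Poincaré forms as derivatives of `σL` -/

theorem mainTheorem7 {n k : ℕ} {E M : Type*}
    [TopologicalSpace E] [ChartedSpace (EuclideanSpace ℝ (Fin (n + k))) E]
    [IsManifold (𝓡 (n + k)) ∞ E]
    [TopologicalSpace M] [ChartedSpace (EuclideanSpace ℝ (Fin n)) M] [IsManifold (𝓡 n) ∞ M]
    (π : CHP.FiberedManifold n k E M) (Λ : CHP.ContravariantVolume n M)
    (L : CHP.AdaptedFrame π → ℝ)
    (hL : ContMDiff 𝓘(ℝ, CHP.Model n k) 𝓘(ℝ, ℝ) ∞ L) (hlift : CHP.IsLifted L) :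
    (ContMDiff 𝓘(ℝ, CHP.Model n k) 𝓘(ℝ, ℝ) ∞ (CHP.sigma (π := π) Λ) ∧
      ∀ u : CHP.AdaptedFrame π, CHP.sigma Λ u ≠ 0) ∧
    ∀ (i : Fin n) (u : CHP.AdaptedFrame π),
      CHP.chpForm (fun m => 1 / (m : ℝ)) L (Sum.inl i) u =
        (1 / CHP.sigma Λ u) •
          CHP.dAlong (CHP.Jtilde π i) (fun v => CHP.sigma Λ v * L v) u := by
  refine ⟨⟨CHP.contMDiff_sigma Λ, CHP.sigma_ne_zero Λ⟩, fun i u => ?_⟩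
  have hLu := (hL u).mdifferentiableAt (by simp)
  -- Liftedness removes `E^{*i}_j(L)`; what remains is the trace term coming from `σ`.
  have hE₁ : ∀ j, CHP.d (fun v => CHP.sigma Λ v * L v) u (CHP.fundamental (CHP.E₁ i j) u) =
      CHP.sigma Λ u * if i = j then L u else 0 := by
    intro j
    rw [CHP.d_sigma_mul_fundamental Λ hLu, CHP.trace_toBlocks₁₁_E₁, hlift.1]
    simp
  have hE₂ : ∀ A, CHP.d (fun v => CHP.sigma Λ v * L v) u (CHP.fundamental (CHP.E₂ i A) u) =
      CHP.sigma Λ u * CHP.d L u (CHP.fundamental (CHP.E₂ i A) u) := by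
    intro A
    rw [CHP.d_sigma_mul_fundamental Λ hLu, CHP.trace_toBlocks₁₁_E₂, zero_mul, zero_add]
  ext X
  change _ = (1 / CHP.sigma Λ u) *
    CHP.dAlong (CHP.Jtilde π i) (fun v => CHP.sigma Λ v * L v) u X
  -- The sum over `j` collapses to `j = i`, and the factor `1/n` of `J̃^i` becomes the normalisation
  -- `τ(n)` of `θ^i_L`.
  have key : CHP.dAlong (CHP.Jtilde π i) (fun v => CHP.sigma Λ v * L v) u X =
      CHP.sigma Λ u * CHP.chpForm (fun m => 1 / (m : ℝ)) L (Sum.inl i) u X := by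
    rw [CHP.dAlong_apply, CHP.Jtilde_apply, CHP.chpForm_inl_apply, map_add, map_smul, map_sum,
      map_sum]
    simp only [map_smul, hE₁, hE₂]
    simp only [smul_eq_mul, mul_ite, mul_zero, Finset.sum_ite_eq, Finset.mem_univ, if_true,
      mul_add, Finset.mul_sum]
    congr 1
    · ring
    · exact Finset.sum_congr rfl fun A _ => by ring
  rw [key, one_div, inv_mul_cancel_left₀ (CHP.sigma_ne_zero Λ u)]
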